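/- Let $\sigma=\mathrm{Prop}\cup\{R_i\mid i\in I\}$ be a modal signature with a finite set $\mathrm{Prop}$ of unary proposition letters and finitely many binary actions $R_i$ ($i\in I$). A $\sigma$-LTS $M_a$ is a (possibly infinite) $\sigma$-structure $M$ with one distinguished state $a$. It is degree-finite if every state has only finitely many successors and only finitely many predecessors along the actions, and connected if any two distinct states are joined by a finite path of transitions, each of which may be traversed in either direction. Let $\mathcal C_\sigma$ be the class of all finite connected $\sigma$-LTSs. A homomorphism $T_c\to M_a$ is a map $\mathrm{dom}(T)\to\mathrm{dom}(M)$ that sends $c$ to $a$ and preserves all proposition letters and all actions; $\mathrm{Hom}(T_c,M_a)$ is the set of these maps, and $\hom_{\mathbb N}(T_c,M_a)=|\mathrm{Hom}(T_c,M_a)|$ when this set is finite. Formulas of hybrid logic $\mathrm{HL}^B(\downarrow,@)$ with backward modalities are generated by $$\varphi ::= p\mid x\mid \varphi\wedge\varphi\mid\varphi\vee\varphi\mid\neg\varphi\mid\Diamond_i\varphi\mid\Box_i\varphi\mid\blacklozenge_i\varphi\mid\;\downarrow x.\,\varphi\mid @_x\varphi,$$ where $p\in\mathrm{Prop}$, $i\in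 I$ and $x$ ranges over a countably infinite set of world variables (there are no nominals). With respect to an assignment $g$ of states to world variables, the propositional letters, Boolean connectives and forward modalities are interpreted as usual at the current state $m$; $\blacklozenge_i\varphi$ holds at $m$ iff $\varphi$ holds at some $n$ with $R_i(n,m)$; $x$ holds at $m$ iff $g(x)=m$; $\downarrow x.\,\varphi$ holds at $m$ under $g$ iff $\varphi$ holds at $m$ under $g[x\mapsto m]$; and $@_x\varphi$ holds at $m$ iff $\varphi$ holds at $g(x)$. A sentence is a formula without free world variables, and $M_a\models\varphi$ means that the sentence $\varphi$ holds at $a$. Write $M_a\equiv_{\mathrm{HL}^B(\downarrow,@)}N_b$ if $M_a$ and $N_b$ satisfy the same sentences. **Theorem.** Let $M_a$ and $N_b$ be degree-finite $\sigma$-LTSs. Then $\mathrm{Hom}(T_c,M_a)$ and $\mathrm{Hom}(T_c,N_b)$ are finite for every $T_c\in\mathcal C_\sigma$, and $$M_a\equiv_{\mathrm{HL}^B(\downarrow,@)}N_b\iff \hom_{\mathbb N}(T_c,M_a)=\hom_{\mathbb N}(T_c,N_b)\ \text{ for all } T_c\in\mathcal C_\sigma.$$ -/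

import Mathlib

universe u v w

/-- A labeled transition system over the modal signature with proposition letters `P` and actions
`R_i`, `i : I`: a first-order structure with one distinguished element. -/
structure LTS (P : Type u) (I : Type v) : Type (max u v (w + 1)) where
  /-- the set of states -/
  Dom : Type w
  /-- `val p m`: the proposition letter `p` holds at the state `m` -/
  val : P → Dom → Prop
  /-- `rel i m n`: there is an `R_i` transition from `m` to `n` -/
  rel : I → Dom → Dom → Prop
  /-- the distinguished state -/
  pt : Dom

namespace LTS

variable {P : Type*} {I : Type*}

/-- The set of successors of a state (along any action). -/
def Succ (M : LTS P I) (m : M.Dom) : Set M.Dom := {n | ∃ i, M.rel i m n}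

/-- The set of predecessors of a state (along any action). -/
def Pred (M : LTS P I) (m : M.Dom) : Set M.Dom := {n | ∃ i, M.rel i n m}

/-- Every state has finitely many successors and finitely many predecessors. -/
def DegreeFinite (M : LTS P I) : Prop :=
  ∀ m : M.Dom, (M.Succ m).Finite ∧ (M.Pred m).Finite

/-- Two states occur together in a transition, in one of the two directions. -/
def Step (M : LTS P I) (m n : M.Dom) : Prop := ∃ i, M.rel i m n ∨ M.rel i n m

/-- Any two states are joined by a finite path of transitions, each of which may be traversed
in either direction. -/
def Connected (M : LTS P I) : Prop :=
  ∀ m n : M.Dom, Relation.ReflTransGen M.Step m n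

/-- Homomorphisms of pointed structures. -/
structure IsHom (T : LTS P I) (M : LTS P I) (h : T.Dom → M.Dom) : Prop where
  map_pt : h T.pt = M.pt
  map_val : ∀ (p : P) (s : T.Dom), T.val p s → M.val p (h s)
  map_rel : ∀ (i : I) (s t : T.Dom), T.rel i s t → M.rel i (h s) (h t)

/-- The set `Hom(T, M)` of homomorphisms from `T` to `M`. -/
def HomSet (T : LTS P I) (M : LTS P I) : Set (T.Dom → M.Dom) := {h | IsHom T M h}

/-- The homomorphism count `|Hom(T, M)|` over the semiring of natural numbers
(meaningful only if `Hom(T, M)` is finite). -/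
noncomputable def homCount (T : LTS P I) (M : LTS P I) : ℕ := (HomSet T M).ncard

/-- The class of finite connected LTSs; up to isomorphism every finite LTS has its states in a
`Type`. -/
def finiteConnected (P : Type*) (I : Type*) : Set (LTS.{_, _, 0} P I) :=
  {T | Finite T.Dom ∧ T.Connected}

/-- The left homomorphism vector of `M` over the natural numbers, restricted to the class `C`. -/
noncomputable def homVector (C : Set (LTS.{_, _, 0} P I)) (M : LTS P I) : C → ℕ :=
  fun T => homCount T.1 M

end LTS

/-- Formulas of the hybrid logic `HL(↓,@)` with backward modalities (and without nominals);
the world variables are indexed by `ℕ`. -/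
inductive HLB (P : Type u) (I : Type v) : Type (max u v)
  /-- a proposition letter -/
  | prop (p : P)
  /-- a world variable -/
  | wvar (x : ℕ)
  | conj (φ ψ : HLB P I)
  | disj (φ ψ : HLB P I)
  | neg (φ : HLB P I)
  /-- the forward diamond of the action `R_i` -/
  | dia (i : I) (φ : HLB P I)
  /-- the forward box of the action `R_i` -/
  | box (i : I) (φ : HLB P I)
  /-- the backward diamond of the action `R_i` -/
  | bdia (i : I) (φ : HLB P I)
  /-- the binder `↓x. φ` -/
  | bind (x : ℕ) (φ : HLB P I)
  /-- the satisfaction operator `@_x φ` -/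
  | atVar (x : ℕ) (φ : HLB P I)

namespace HLB

variable {P : Type*} {I : Type*}

/-- The world variables with a free occurrence in a formula. -/
def freeVars : HLB P I → Set ℕ
  | prop _ => ∅
  | wvar x => {x}
  | conj φ ψ => φ.freeVars ∪ ψ.freeVars
  | disj φ ψ => φ.freeVars ∪ ψ.freeVars
  | neg φ => φ.freeVars
  | dia _ φ => φ.freeVars
  | box _ φ => φ.freeVars
  | bdia _ φ => φ.freeVars
  | bind x φ => φ.freeVars \ {x}
  | atVar x φ => {x} ∪ φ.freeVars

/-- A sentence has no free world variables. -/
def IsSentence (φ : HLB P I) : Prop := φ.freeVars = ∅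

/-- Satisfaction of a formula at the state `a` of `M` under the assignment `g`. -/
def Sat (M : LTS P I) : M.Dom → (ℕ → M.Dom) → HLB P I → Prop
  | a, _, prop p => M.val p a
  | a, g, wvar x => g x = a
  | a, g, conj φ ψ => Sat M a g φ ∧ Sat M a g ψ
  | a, g, disj φ ψ => Sat M a g φ ∨ Sat M a g ψ
  | a, g, neg φ => ¬ Sat M a g φ
  | a, g, dia i φ => ∃ b, M.rel i a b ∧ Sat M b g φ
  | a, g, box i φ => ∀ b, M.rel i a b → Sat M b g φ
  | a, g, bdia i φ => ∃ b, M.rel i b a ∧ Sat M b g φ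
  | a, g, bind x φ => Sat M a (Function.update g x a) φ
  | _, g, atVar x φ => Sat M (g x) g φ

/-- Satisfaction depends only on the values of the assignment at the free variables. -/
theorem sat_congr (M : LTS P I) (φ : HLB P I) : ∀ (a : M.Dom) (g g' : ℕ → M.Dom),
    (∀ x ∈ φ.freeVars, g x = g' x) → (Sat M a g φ ↔ Sat M a g' φ) := by
  induction φ with
  | prop p => intro a g g' _; rfl
  | wvar x => intro a g g' h; simp only [Sat, h x rfl]
  | conj φ ψ ih1 ih2 =>
    intro a g g' h
    simp only [Sat]
    rw [ih1 a g g' fun x hx => h x (Or.inl hx), ih2 a g g' fun x hx => h x (Or.inr hx)]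
  | disj φ ψ ih1 ih2 =>
    intro a g g' h
    simp only [Sat]
    rw [ih1 a g g' fun x hx => h x (Or.inl hx), ih2 a g g' fun x hx => h x (Or.inr hx)]
  | neg φ ih => intro a g g' h; simp only [Sat]; rw [ih a g g' h]
  | dia i φ ih => intro a g g' h; simp only [Sat, ih _ g g' h]
  | box i φ ih => intro a g g' h; simp only [Sat, ih _ g g' h]
  | bdia i φ ih => intro a g g' h; simp only [Sat, ih _ g g' h]
  | bind x φ ih =>
    intro a g g' h
    simp only [Sat]
    refine ih a _ _ fun y hy => ?_
    by_cases hxy : y = x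
    · simp [hxy]
    · simp only [Function.update_of_ne hxy]; exact h y ⟨hy, hxy⟩
  | atVar x φ ih =>
    intro a g g' h
    simp only [Sat]
    rw [h x (Or.inl rfl)]
    exact ih _ g g' fun y hy => h y (Or.inr hy)

/-- Truth of a sentence in an LTS. -/
def Models (M : LTS P I) (φ : HLB P I) : Prop := ∀ g : ℕ → M.Dom, Sat M M.pt g φ

/-- For a sentence the chosen assignment does not matter. -/
theorem models_iff_sat (M : LTS P I) (φ : HLB P I) (hφ : φ.IsSentence) (g : ℕ → M.Dom) :
    Models M φ ↔ Sat M M.pt g φ := by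
  refine ⟨fun h => h g, fun h g' => (sat_congr M φ M.pt g g' fun x hx => ?_).1 h⟩
  rw [IsSentence] at hφ
  simp [hφ] at hx

/-- `M` and `N` satisfy the same sentences. -/
def Equivalent (M : LTS P I) (N : LTS P I) : Prop :=
  ∀ φ : HLB P I, φ.IsSentence → (Models M φ ↔ Models N φ)

end HLB

/-! Both sides of the equivalence amount to information about balls of finite radius around the
distinguished states. Degree-finiteness makes these balls finite, and a homomorphism from a finite
connected `T` maps into such a ball, so `Hom(T, M)` is finite.

From counts to logic: sorting homomorphisms by kernel writes `homCount T M` as a sum, over the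
quotients of `T`, of numbers of injective homomorphisms. Induction on the size of `T` inverts this,
so injective counts agree too (`ncard_injective_eq`). Applied to the balls themselves, this gives
injective homomorphisms both ways between balls of equal radius; by finiteness they are isomorphic
(`exists_ballIso`). A sentence of modal depth `r` only sees the ball of radius `r`
(`sat_iff_of_ballIso`).

From logic to counts: "there are at least `k` homomorphisms from `T`" is a sentence. Backward and
forward steps, `↓` and `@` quantify over a ball around the root, which contains all values of such
homomorphisms (`Equivalent.homCount_le`). Symmetry gives equality. -/

namespace LTS

variable {P : Type*} {I : Type*}

/-! ### Balls -/

/-- The states that are reached from `a` by at most `n` steps, forward or backward. -/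
def ball (M : LTS P I) (a : M.Dom) : ℕ → Set M.Dom
  | 0 => {a}
  | n + 1 => M.ball a n ∪ {y | ∃ x ∈ M.ball a n, M.Step x y}

theorem ball_subset_succ (M : LTS P I) (a : M.Dom) (n : ℕ) : M.ball a n ⊆ M.ball a (n + 1) :=
  Set.subset_union_left

theorem ball_mono (M : LTS P I) (a : M.Dom) : Monotone (M.ball a) :=
  monotone_nat_of_le_succ (M.ball_subset_succ a)

theorem step_mem_ball {M : LTS P I} {a x y : M.Dom} {n : ℕ} (hx : x ∈ M.ball a n)
    (h : M.Step x y) : y ∈ M.ball a (n + 1) :=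
  Or.inr ⟨x, hx, h⟩

theorem self_mem_ball (M : LTS P I) (a : M.Dom) (n : ℕ) : a ∈ M.ball a n :=
  M.ball_mono a (Nat.zero_le n) rfl

theorem Step.symm {M : LTS P I} {x y : M.Dom} (h : M.Step x y) : M.Step y x :=
  h.imp fun _ => Or.symm

theorem DegreeFinite.finite_ball {M : LTS P I} (hM : M.DegreeFinite) (a : M.Dom) (n : ℕ) :
    (M.ball a n).Finite := by
  induction n with
  | zero => exact Set.finite_singleton a
  | succ n ih =>
    refine ih.union ((ih.biUnion fun x _ => (hM x).1.union (hM x).2).subset ?_)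
    rintro y ⟨x, hx, i, h | h⟩
    · exact Set.mem_biUnion hx (Or.inl ⟨i, h⟩)
    · exact Set.mem_biUnion hx (Or.inr ⟨i, h⟩)

theorem exists_mem_ball_of_reflTransGen {M : LTS P I} {a b : M.Dom}
    (h : Relation.ReflTransGen M.Step a b) : ∃ n, b ∈ M.ball a n := by
  induction h with
  | refl => exact ⟨0, rfl⟩
  | tail _ h ih =>
    obtain ⟨n, hn⟩ := ih
    exact ⟨n + 1, step_mem_ball hn h⟩

theorem Connected.exists_ball {T : LTS P I} [Finite T.Dom] (hT : T.Connected) :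
    ∃ r, ∀ t, t ∈ T.ball T.pt r := by
  choose n hn using fun t => exists_mem_ball_of_reflTransGen (hT T.pt t)
  obtain ⟨r, hr⟩ := (Set.finite_range n).bddAbove
  exact ⟨r, fun t => T.ball_mono T.pt (hr ⟨t, rfl⟩) (hn t)⟩

theorem connected_of_reflTransGen {T : LTS P I}
    (h : ∀ t, Relation.ReflTransGen T.Step T.pt t) : T.Connected := fun s t =>
  have : Std.Symm T.Step := ⟨fun _ _ => Step.symm⟩
  (Relation.ReflTransGen.stdSymm.symm _ _ (h s)).trans (h t)

namespace IsHom

variable {T M : LTS P I}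

theorem map_step {h : T.Dom → M.Dom} (hh : IsHom T M h) {s t : T.Dom} (hst : T.Step s t) :
    M.Step (h s) (h t) :=
  hst.imp fun i => Or.imp (hh.map_rel i s t) (hh.map_rel i t s)

theorem map_ball {h : T.Dom → M.Dom} (hh : IsHom T M h) {t : T.Dom} {n : ℕ}
    (ht : t ∈ T.ball T.pt n) : h t ∈ M.ball M.pt n := by
  induction n generalizing t with
  | zero => rw [show t = T.pt from ht, hh.map_pt]; rfl
  | succ n ih =>
    rcases ht with ht | ⟨s, hs, hst⟩
    · exact Or.inl (ih ht)
    · exact step_mem_ball (ih hs) (hh.map_step hst)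

end IsHom

theorem DegreeFinite.finite_homSet {M T : LTS P I} (hM : M.DegreeFinite) [Finite T.Dom]
    (hT : T.Connected) : (HomSet T M).Finite := by
  obtain ⟨r, hr⟩ := hT.exists_ball
  exact (Set.Finite.pi' fun _ : T.Dom => hM.finite_ball M.pt r).subset fun h hh t =>
    IsHom.map_ball hh (hr t)

/-! ### Quotients and injective homomorphisms -/

/-- The quotient of an LTS by an equivalence relation, with the least structure that makes the
projection a homomorphism. -/
def quot (T : LTS P I) (θ : Setoid T.Dom) : LTS P I where
  Dom := Quotient θ
  val p x := ∃ s, Quotient.mk θ s = x ∧ T.val p s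
  rel i x y := ∃ s t, Quotient.mk θ s = x ∧ Quotient.mk θ t = y ∧ T.rel i s t
  pt := Quotient.mk θ T.pt

theorem isHom_mk (T : LTS P I) (θ : Setoid T.Dom) : IsHom T (T.quot θ) (Quotient.mk θ) where
  map_pt := rfl
  map_val _ s h := ⟨s, rfl, h⟩
  map_rel _ s t h := ⟨s, t, rfl, rfl, h⟩

theorem Connected.quot {T : LTS P I} (hT : T.Connected) (θ : Setoid T.Dom) :
    (T.quot θ).Connected := by
  intro x y
  induction x using Quotient.inductionOn with | _ s
  induction y using Quotient.inductionOn with | _ t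
  exact (hT s t).lift (Quotient.mk θ) fun _ _ h => (T.isHom_mk θ).map_step h

/-- The homomorphisms with kernel `θ`. -/
def kerHomSet (T : LTS P I) (M : LTS P I) (θ : Setoid T.Dom) : Set (T.Dom → M.Dom) :=
  {h | IsHom T M h ∧ Setoid.ker h = θ}

/-- Kernel `⊥` encodes injectivity. A homomorphism with kernel `θ` factors uniquely through the
quotient as an injective map, which is again a homomorphism because the quotient carries the least
structure. -/
theorem ncard_kerHomSet (T : LTS P I) (M : LTS P I) (θ : Setoid T.Dom) :
    (kerHomSet T M θ).ncard = (kerHomSet (T.quot θ) M ⊥).ncard := by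
  symm
  refine Set.ncard_congr (fun h _ => h ∘ Quotient.mk θ) ?_ ?_ ?_
  · rintro h ⟨hh, hk⟩
    refine ⟨⟨hh.map_pt, fun p s hs => hh.map_val p _ ⟨s, rfl, hs⟩,
      fun i s t hst => hh.map_rel i _ _ ⟨s, t, rfl, rfl, hst⟩⟩, ?_⟩
    have hinj := Setoid.ker_eq_bot_iff.1 hk
    ext s t
    exact hinj.eq_iff.trans Quotient.eq
  · intro h h' _ _ e
    funext x
    induction x using Quotient.inductionOn with | _ s
    exact congrFun e s
  · rintro f ⟨hf, rfl⟩
    refine ⟨Quotient.lift f fun _ _ h => h, ⟨⟨hf.map_pt, ?_, ?_⟩, ?_⟩, rfl⟩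
    · rintro p _ ⟨s, rfl, hs⟩
      exact hf.map_val p s hs
    · rintro i _ _ ⟨s, t, rfl, rfl, hst⟩
      exact hf.map_rel i s t hst
    · refine Setoid.ker_eq_bot_iff.2 fun x y => ?_
      induction x using Quotient.inductionOn with | _ s
      induction y using Quotient.inductionOn with | _ t
      exact fun h => Quotient.sound h

open Classical in
theorem homCount_eq_sum (T : LTS P I) (M : LTS P I) [Fintype (Setoid T.Dom)]
    (hfin : (HomSet T M).Finite) :
    homCount T M = ∑ θ : Setoid T.Dom, (kerHomSet T M θ).ncard := by
  rw [homCount, Set.ncard_eq_toFinset_card _ hfin,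
    Finset.card_eq_sum_card_fiberwise (f := fun h => Setoid.ker h) (t := Finset.univ)
      (fun _ _ => Finset.mem_coe.2 (Finset.mem_univ _))]
  refine Finset.sum_congr rfl fun θ _ => ?_
  rw [← Set.ncard_coe_finset]
  congr 1
  ext h
  simp [kerHomSet, HomSet]

theorem card_quotient_lt {α : Type*} [Finite α] {θ : Setoid α} (hθ : θ ≠ ⊥) :
    Nat.card (Quotient θ) < Nat.card α := by
  refine lt_of_le_of_ne (Nat.card_le_card_of_surjective _ Quotient.mk_surjective) fun h => hθ ?_
  have hinj : Function.Injective (Quotient.mk θ) :=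
    ((Nat.bijective_iff_surjective_and_card _).2 ⟨Quotient.mk_surjective, h.symm⟩).1
  rw [← Setoid.ker_mk_eq θ]
  exact Setoid.ker_eq_bot_iff.2 hinj

/-- If all finite connected LTSs have the same numbers of homomorphisms to `M` and `N`, then they
have the same numbers of injective homomorphisms to `M` and `N`. -/
theorem ncard_injective_eq {M N : LTS P I} (hM : M.DegreeFinite) (hN : N.DegreeFinite)
    (h : ∀ T ∈ finiteConnected P I, homCount T M = homCount T N) :
    ∀ T ∈ finiteConnected P I, (kerHomSet T M ⊥).ncard = (kerHomSet T N ⊥).ncard := by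
  intro T hT
  -- A quotient by `θ ≠ ⊥` is connected and has fewer states, so every summand except the one for
  -- `⊥` is settled by induction and cancels.
  induction hn : Nat.card T.Dom using Nat.strong_induction_on generalizing T with | _ n ih
  classical
  obtain ⟨hfin, hconn⟩ := id hT
  have : Finite (Setoid T.Dom) :=
    Finite.of_injective (fun θ : Setoid T.Dom => θ.r) fun θ θ' e => Setoid.ext fun a b =>
      iff_of_eq (congrFun (congrFun e a) b)
  have := Fintype.ofFinite (Setoid T.Dom)
  have key := h T hT
  rw [homCount_eq_sum T M (hM.finite_homSet hconn), homCount_eq_sum T N (hN.finite_homSet hconn),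
    ← Finset.add_sum_erase _ _ (Finset.mem_univ ⊥),
    ← Finset.add_sum_erase _ _ (Finset.mem_univ ⊥)] at key
  refine Nat.add_right_cancel (key.trans (congrArg _ (Finset.sum_congr rfl fun θ hθ => ?_)).symm)
  rw [ncard_kerHomSet, ncard_kerHomSet T N]
  exact ih _ (hn ▸ card_quotient_lt (Finset.ne_of_mem_erase hθ)) _
    ⟨inferInstanceAs (Finite (Quotient θ)), hconn.quot θ⟩ rfl

/-! ### Isomorphism of balls -/

/-- The structure induced along a map from a set of indices. -/
def comap (M : LTS P I) {K : Type*} (f : K → M.Dom) (k : K) : LTS P I where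
  Dom := K
  val p s := M.val p (f s)
  rel i s t := M.rel i (f s) (f t)
  pt := k

/-- A numbering of the states of a ball. -/
theorem DegreeFinite.exists_ball_numbering {M : LTS P I} (hM : M.DegreeFinite) (r : ℕ) :
    ∃ (m : ℕ) (f : Fin m → M.Dom) (k : Fin m), Function.Injective f ∧
      Set.range f = M.ball M.pt r ∧ f k = M.pt := by
  have := (hM.finite_ball M.pt r).to_subtype
  have e := Finite.equivFin (M.ball M.pt r)
  refine ⟨_, fun x => (e.symm x).1, e ⟨M.pt, M.self_mem_ball _ r⟩,
    Subtype.val_injective.comp e.symm.injective, ?_, congrArg Subtype.val (e.symm_apply_apply _)⟩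
  have := e.symm.surjective.range_comp (Subtype.val : M.ball M.pt r → M.Dom)
  rw [Subtype.range_coe] at this
  exact this

/-- A path witnessing that a state lies in the ball has all its states in the ball, so it survives
in the induced structure. -/
theorem comap_ball_connected (M : LTS P I) {K : Type*} {f : K → M.Dom} {k : K} {r : ℕ}
    (hf : Function.Injective f) (hr : Set.range f = M.ball M.pt r) (hk : f k = M.pt) :
    (M.comap f k).Connected := by
  refine connected_of_reflTransGen fun t => ?_
  suffices ∀ n ≤ r, ∀ t, f t ∈ M.ball M.pt n → Relation.ReflTransGen (M.comap f k).Step k t from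
    this r le_rfl t (hr ▸ ⟨t, rfl⟩)
  intro n
  induction n with
  | zero =>
    intro _ t ht
    rw [hf ((show f t = M.pt from ht).trans hk.symm)]
    exact Relation.ReflTransGen.refl
  | succ n ih =>
    rintro hn t (ht | ⟨x, hx, hst⟩)
    · exact ih (by omega) t ht
    · obtain ⟨s, rfl⟩ : x ∈ Set.range f := hr ▸ M.ball_mono _ (by omega) hx
      exact (ih (by omega) s hx).tail hst

theorem IsHom.comp_comap {M N : LTS P I} {K L : Type*} {f : K → M.Dom} {k : K} {g : L → N.Dom}
    {l : L} (hg : Function.Injective g) (hl : g l = N.pt) {h : K → N.Dom} {u : K → L}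
    (hh : IsHom (M.comap f k) N h) (hu : g ∘ u = h) : IsHom (M.comap f k) (N.comap g l) u := by
  subst hu
  exact ⟨hg (hh.map_pt.trans hl.symm), hh.map_val, hh.map_rel⟩

/-- An injective homomorphism from the ball of `M` to `N` is one between the balls. -/
theorem exists_injective_hom_comap {M N : LTS P I} {K L : Type*} {f : K → M.Dom} {k : K}
    {g : L → N.Dom} {l : L} {r : ℕ} (hf : Function.Injective f)
    (hfr : Set.range f = M.ball M.pt r) (hk : f k = M.pt) (hg : Function.Injective g)
    (hgr : Set.range g = N.ball N.pt r) (hl : g l = N.pt)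
    (h : (kerHomSet (M.comap f k) N ⊥).Nonempty) :
    ∃ u : K → L, Function.Injective u ∧ IsHom (M.comap f k) (N.comap g l) u := by
  obtain ⟨h, hh, hker⟩ := h
  have hinj : Function.Injective h := Setoid.ker_eq_bot_iff.1 hker
  -- Distance is measured in `M`, while `h` is defined only on the ball; the bound `n ≤ r` keeps the
  -- intermediate states in its domain.
  have hball : ∀ n ≤ r, ∀ t : K, f t ∈ M.ball M.pt n → h t ∈ N.ball N.pt n := by
    intro n
    induction n with
    | zero =>
      intro _ t ht
      rw [hf ((show f t = M.pt from ht).trans hk.symm)]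
      exact hh.map_pt
    | succ n ih =>
      rintro hn t (ht | ⟨x, hx, hst⟩)
      · exact Or.inl (ih (by omega) t ht)
      · obtain ⟨s, rfl⟩ : x ∈ Set.range f := hfr ▸ M.ball_mono _ (by omega) hx
        exact step_mem_ball (ih (by omega) s hx) (hh.map_step (s := s) (t := t) hst)
  have hmem : ∀ t : K, h t ∈ Set.range g := fun t => hgr ▸ hball r le_rfl t (hfr ▸ ⟨t, rfl⟩)
  choose u hu using hmem
  have hu' : g ∘ u = h := funext hu
  exact ⟨u, Function.Injective.of_comp (f := g) (hu' ▸ hinj), hh.comp_comap hg hl hu'⟩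

/-- An injective self-map of a finite type that preserves a relation reflects it. -/
theorem rel_of_injective_of_preserves {α : Type*} [Finite α] {w : α → α}
    (hw : Function.Injective w) {ρ : α → α → Prop} (hρ : ∀ s t, ρ s t → ρ (w s) (w t)) {s t : α}
    (h : ρ (w s) (w t)) : ρ s t := by
  let e := Equiv.ofBijective w (Finite.injective_iff_bijective.1 hw)
  have hpow : ∀ (n : ℕ) (s t : α), ρ s t → ρ ((e ^ n) s) ((e ^ n) t) := by
    intro n
    induction n with
    | zero => exact fun _ _ => id
    | succ n ih => exact fun s t h => ih _ _ (hρ s t h)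
  -- The inverse of `e` is the power `e ^ (orderOf e - 1)`, so it preserves `ρ` as well.
  have hpos := orderOf_pos e
  have := hpow (orderOf e - 1) _ _ h
  change ρ ((e ^ (orderOf e - 1) * e) s) ((e ^ (orderOf e - 1) * e) t) at this
  rwa [← pow_succ, Nat.sub_add_cancel hpos, pow_orderOf_eq_one] at this

/-- The balls of radius `r` in `M` and `N` are isomorphic: `f` and `f'` number their states in
the same way. -/
structure BallIso (M : LTS P I) (N : LTS P I) (r : ℕ) {K : Type*} (f : K → M.Dom)
    (f' : K → N.Dom) (k : K) : Prop where
  injective : Function.Injective f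
  injective' : Function.Injective f'
  range : Set.range f = M.ball M.pt r
  range' : Set.range f' = N.ball N.pt r
  pt : f k = M.pt
  pt' : f' k = N.pt
  val : ∀ p s, M.val p (f s) ↔ N.val p (f' s)
  rel : ∀ i s t, M.rel i (f s) (f t) ↔ N.rel i (f' s) (f' t)

/-- The inclusion of a ball is an injective homomorphism, so equality of injective counts yields
injections `u` and `v` between the two balls. Then `u` is bijective by cardinality, and it reflects
the structure because the injective self-map `v ∘ u` does. -/
theorem exists_ballIso {M N : LTS P I} (hM : M.DegreeFinite) (hN : N.DegreeFinite)
    (h : ∀ T ∈ finiteConnected P I, homCount T M = homCount T N) (r : ℕ) :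
    ∃ (m : ℕ) (f : Fin m → M.Dom) (f' : Fin m → N.Dom) (k : Fin m), BallIso M N r f f' k := by
  have hinj := ncard_injective_eq hM hN h
  obtain ⟨m, f, k, hf, hfr, hk⟩ := hM.exists_ball_numbering r
  obtain ⟨n, g, l, hg, hgr, hl⟩ := hN.exists_ball_numbering r
  have hTM : M.comap f k ∈ finiteConnected P I :=
    ⟨inferInstanceAs (Finite (Fin m)), M.comap_ball_connected hf hfr hk⟩
  have hTN : N.comap g l ∈ finiteConnected P I :=
    ⟨inferInstanceAs (Finite (Fin n)), N.comap_ball_connected hg hgr hl⟩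
  obtain ⟨u, hu, huh⟩ := exists_injective_hom_comap hf hfr hk hg hgr hl <| by
    refine Set.nonempty_of_ncard_ne_zero ((hinj _ hTM).symm.trans_ne ?_)
    refine Set.ncard_ne_zero_of_mem (a := f) ⟨⟨hk, fun _ _ => id, fun _ _ _ => id⟩,
      Setoid.ker_eq_bot_iff.2 hf⟩ ?_
    have := hTM.1
    exact (hM.finite_homSet hTM.2).subset fun _ h => h.1
  obtain ⟨v, hv, hvh⟩ := exists_injective_hom_comap hg hgr hl hf hfr hk <| by
    refine Set.nonempty_of_ncard_ne_zero ((hinj _ hTN).trans_ne ?_)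
    refine Set.ncard_ne_zero_of_mem (a := g) ⟨⟨hl, fun _ _ => id, fun _ _ _ => id⟩,
      Setoid.ker_eq_bot_iff.2 hg⟩ ?_
    have := hTN.1
    exact (hN.finite_homSet hTN.2).subset fun _ h => h.1
  have hcard : m = n := le_antisymm (by simpa using Fintype.card_le_of_injective u hu)
    (by simpa using Fintype.card_le_of_injective v hv)
  subst hcard
  have hvu : Function.Injective (v ∘ u) := hv.comp hu
  refine ⟨m, f, g ∘ u, k, hf, hg.comp hu, hfr, ?_, hk, (congrArg g huh.map_pt).trans hl,
    fun p s => ⟨huh.map_val p s, fun h => ?_⟩, fun i s t => ⟨huh.map_rel i s t, fun h => ?_⟩⟩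
  · rw [(Finite.injective_iff_surjective.1 hu).range_comp, hgr]
  -- A proposition letter is treated as a binary relation that ignores its second argument.
  · exact rel_of_injective_of_preserves hvu (ρ := fun s _ => M.val p (f s)) (t := s)
      (fun s _ h => hvh.map_val p _ (huh.map_val p s h)) (hvh.map_val p _ h)
  · exact rel_of_injective_of_preserves hvu (ρ := fun s t => M.rel i (f s) (f t))
      (fun s t h => hvh.map_rel i _ _ (huh.map_rel i s t h)) (hvh.map_rel i _ _ h)

end LTS

namespace HLB

open LTS

variable {P : Type*} {I : Type*}

/-! ### Invariance under isomorphism of balls -/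

/-- The maximal number of nested modalities. -/
def depth : HLB P I → ℕ
  | prop _ => 0
  | wvar _ => 0
  | conj φ ψ => max φ.depth ψ.depth
  | disj φ ψ => max φ.depth ψ.depth
  | neg φ => φ.depth
  | dia _ φ => φ.depth + 1
  | box _ φ => φ.depth + 1
  | bdia _ φ => φ.depth + 1
  | bind _ φ => φ.depth
  | atVar _ φ => φ.depth

/-- The radius is a budget: each modality moves at most one step outward and lowers the remaining
depth by one. Since `@` can jump to any variable, the values of the assignment must obey the same
bound as the current state. -/
theorem sat_iff_of_ballIso {M : LTS P I} {N : LTS P I} {r : ℕ} {K : Type*} {f : K → M.Dom}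
    {f' : K → N.Dom} {k : K} (h : BallIso M N r f f' k) (φ : HLB P I) :
    ∀ (n : ℕ) (s : K) (g : ℕ → K), n + φ.depth ≤ r →
      f s ∈ M.ball M.pt n → f' s ∈ N.ball N.pt n →
      (∀ x, f (g x) ∈ M.ball M.pt n) → (∀ x, f' (g x) ∈ N.ball N.pt n) →
      (Sat M (f s) (f ∘ g) φ ↔ Sat N (f' s) (f' ∘ g) φ) := by
  have hsucc : ∀ {n x}, x ∈ M.ball M.pt n → x ∈ M.ball M.pt (n + 1) :=
    fun h => M.ball_subset_succ _ _ h
  have hsucc' : ∀ {n x}, x ∈ N.ball N.pt n → x ∈ N.ball N.pt (n + 1) :=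
    fun h => N.ball_subset_succ _ _ h
  have step : ∀ {n : ℕ} {s : K} {b : M.Dom}, n + 1 ≤ r → f s ∈ M.ball M.pt n → M.Step (f s) b →
      ∃ t, f t = b := fun {n s b} hn hs hst => by
    have : b ∈ Set.range f := h.range ▸ M.ball_mono _ hn (step_mem_ball hs hst)
    exact this
  have step' : ∀ {n : ℕ} {s : K} {b : N.Dom}, n + 1 ≤ r → f' s ∈ N.ball N.pt n →
      N.Step (f' s) b → ∃ t, f' t = b := fun {n s b} hn hs hst => by
    have : b ∈ Set.range f' := h.range' ▸ N.ball_mono _ hn (step_mem_ball hs hst)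
    exact this
  induction φ with
  | prop p => exact fun n s g _ _ _ _ _ => h.val p s
  | wvar x => exact fun n s g _ _ _ _ _ => h.injective.eq_iff.trans h.injective'.eq_iff.symm
  | conj φ ψ ih1 ih2 =>
    intro n s g hn hs hs' hg hg'
    simp only [depth] at hn
    exact and_congr (ih1 n s g (by omega) hs hs' hg hg') (ih2 n s g (by omega) hs hs' hg hg')
  | disj φ ψ ih1 ih2 =>
    intro n s g hn hs hs' hg hg'
    simp only [depth] at hn
    exact or_congr (ih1 n s g (by omega) hs hs' hg hg') (ih2 n s g (by omega) hs hs' hg hg')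
  | neg φ ih => exact fun n s g hn hs hs' hg hg' => not_congr (ih n s g hn hs hs' hg hg')
  | dia i φ ih =>
    intro n s g hn hs hs' hg hg'
    simp only [depth] at hn
    have key : ∀ t, M.rel i (f s) (f t) → (Sat M (f t) (f ∘ g) φ ↔ Sat N (f' t) (f' ∘ g) φ) :=
      fun t ht => ih (n + 1) t g (by omega) (step_mem_ball hs ⟨i, Or.inl ht⟩)
        (step_mem_ball hs' ⟨i, Or.inl ((h.rel i s t).1 ht)⟩) (fun x => hsucc (hg x))
        (fun x => hsucc' (hg' x))
    constructor
    · rintro ⟨b, hb, hφ⟩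
      obtain ⟨t, rfl⟩ := step (by omega) hs ⟨i, Or.inl hb⟩
      exact ⟨f' t, (h.rel i s t).1 hb, (key t hb).1 hφ⟩
    · rintro ⟨b, hb, hφ⟩
      obtain ⟨t, rfl⟩ := step' (by omega) hs' ⟨i, Or.inl hb⟩
      have hb := (h.rel i s t).2 hb
      exact ⟨f t, hb, (key t hb).2 hφ⟩
  | box i φ ih =>
    intro n s g hn hs hs' hg hg'
    simp only [depth] at hn
    have key : ∀ t, M.rel i (f s) (f t) → (Sat M (f t) (f ∘ g) φ ↔ Sat N (f' t) (f' ∘ g) φ) :=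
      fun t ht => ih (n + 1) t g (by omega) (step_mem_ball hs ⟨i, Or.inl ht⟩)
        (step_mem_ball hs' ⟨i, Or.inl ((h.rel i s t).1 ht)⟩) (fun x => hsucc (hg x))
        (fun x => hsucc' (hg' x))
    constructor
    · intro hφ b hb
      obtain ⟨t, rfl⟩ := step' (by omega) hs' ⟨i, Or.inl hb⟩
      have hb := (h.rel i s t).2 hb
      exact (key t hb).1 (hφ _ hb)
    · intro hφ b hb
      obtain ⟨t, rfl⟩ := step (by omega) hs ⟨i, Or.inl hb⟩
      exact (key t hb).2 (hφ _ ((h.rel i s t).1 hb))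
  | bdia i φ ih =>
    intro n s g hn hs hs' hg hg'
    simp only [depth] at hn
    have key : ∀ t, M.rel i (f t) (f s) → (Sat M (f t) (f ∘ g) φ ↔ Sat N (f' t) (f' ∘ g) φ) :=
      fun t ht => ih (n + 1) t g (by omega) (step_mem_ball hs ⟨i, Or.inr ht⟩)
        (step_mem_ball hs' ⟨i, Or.inr ((h.rel i t s).1 ht)⟩) (fun x => hsucc (hg x))
        (fun x => hsucc' (hg' x))
    constructor
    · rintro ⟨b, hb, hφ⟩
      obtain ⟨t, rfl⟩ := step (by omega) hs ⟨i, Or.inr hb⟩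
      exact ⟨f' t, (h.rel i t s).1 hb, (key t hb).1 hφ⟩
    · rintro ⟨b, hb, hφ⟩
      obtain ⟨t, rfl⟩ := step' (by omega) hs' ⟨i, Or.inr hb⟩
      have hb := (h.rel i t s).2 hb
      exact ⟨f t, hb, (key t hb).2 hφ⟩
  | bind x φ ih =>
    intro n s g hn hs hs' hg hg'
    have := ih n s (Function.update g x s) hn hs hs'
      (fun y => by by_cases hy : y = x <;> simp [hy, hs, hg])
      (fun y => by by_cases hy : y = x <;> simp [hy, hs', hg'])
    simpa only [Sat, Function.comp_update] using this
  | atVar x φ ih => exact fun n s g hn hs hs' hg hg' => ih n (g x) g hn (hg x) (hg' x) hg hg'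

theorem equivalent_of_ballIso {M : LTS P I} {N : LTS P I}
    (h : ∀ r, ∃ (m : ℕ) (f : Fin m → M.Dom) (f' : Fin m → N.Dom) (k : Fin m),
      BallIso M N r f f' k) : Equivalent M N := by
  intro φ hφ
  obtain ⟨m, f, f', k, hf⟩ := h φ.depth
  rw [models_iff_sat M φ hφ (f ∘ fun _ => k), models_iff_sat N φ hφ (f' ∘ fun _ => k)]
  have := sat_iff_of_ballIso hf φ 0 k (fun _ => k) (by omega) hf.pt hf.pt' (fun _ => hf.pt)
    (fun _ => hf.pt')
  rwa [hf.pt, hf.pt'] at this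

/-! ### Counting homomorphisms by a sentence -/

/-- A conjunction over a finite family. -/
noncomputable def conjAll {ι : Type*} [Finite ι] (F : ι → HLB P I) : HLB P I :=
  -- The closed formula `↓x. x` holds everywhere and serves as the empty conjunction.
  ((Fintype.ofFinite ι).elems.toList.map F).foldr conj (bind 0 (wvar 0))

theorem sat_conjAll {ι : Type*} [Finite ι] (F : ι → HLB P I) (M : LTS P I) (a : M.Dom)
    (g : ℕ → M.Dom) : Sat M a g (conjAll F) ↔ ∀ i, Sat M a g (F i) := by
  have : ∀ l : List ι, Sat M a g ((l.map F).foldr conj (bind 0 (wvar 0))) ↔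
      ∀ i ∈ l, Sat M a g (F i) := by
    intro l
    induction l with
    | nil => simp [Sat]
    | cons i l ih => simp [Sat, ih]
  rw [conjAll, this]
  exact ⟨fun h i => h i (Finset.mem_toList.2 ((Fintype.ofFinite ι).complete i)), fun h i _ => h i⟩

theorem freeVars_conjAll {ι : Type*} [Finite ι] {F : ι → HLB P I} {s : Set ℕ}
    (h : ∀ i, (F i).freeVars ⊆ s) : (conjAll F).freeVars ⊆ s := by
  rw [conjAll]
  induction (Fintype.ofFinite ι).elems.toList with
  | nil => simp [freeVars]
  | cons i l ih => exact Set.union_subset (h i) ih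

section

variable [Finite I]

/-- `φ` holds at some state that is reached by at most `n` steps, forward or backward. -/
noncomputable def reach : ℕ → HLB P I → HLB P I
  | 0, φ => φ
  -- The negated conjunction of negations is the disjunction over the finitely many actions.
  | n + 1, φ => reach n (disj φ (neg (conjAll fun i => neg (disj (dia i φ) (bdia i φ)))))

theorem freeVars_reach (n : ℕ) (φ : HLB P I) : (reach n φ).freeVars ⊆ φ.freeVars := by
  induction n generalizing φ with
  | zero => exact subset_rfl
  | succ n ih =>
    refine (ih _).trans (Set.union_subset subset_rfl (freeVars_conjAll fun i => ?_))
    exact Set.union_subset subset_rfl subset_rfl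

theorem sat_reach (n : ℕ) (φ : HLB P I) (M : LTS P I) (a : M.Dom) (g : ℕ → M.Dom) :
    Sat M a g (reach n φ) ↔ ∃ b ∈ M.ball a n, Sat M b g φ := by
  induction n generalizing φ with
  | zero => simp [reach, ball]
  | succ n ih =>
    have hstep : ∀ b, Sat M b g (disj φ (neg (conjAll fun i => neg (disj (dia i φ) (bdia i φ)))))
        ↔ Sat M b g φ ∨ ∃ c, M.Step b c ∧ Sat M c g φ := by
      intro b
      simp only [Sat, sat_conjAll, not_forall, not_not, Step]
      refine or_congr Iff.rfl ⟨?_, ?_⟩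
      · rintro ⟨i, ⟨c, h, hc⟩ | ⟨c, h, hc⟩⟩
        exacts [⟨c, ⟨i, Or.inl h⟩, hc⟩, ⟨c, ⟨i, Or.inr h⟩, hc⟩]
      · rintro ⟨c, ⟨i, h | h⟩, hc⟩
        exacts [⟨i, Or.inl ⟨c, h, hc⟩⟩, ⟨i, Or.inr ⟨c, h, hc⟩⟩]
    simp only [reach, ih, hstep]
    constructor
    · rintro ⟨b, hb, h | ⟨c, hbc, h⟩⟩
      exacts [⟨b, M.ball_subset_succ _ _ hb, h⟩, ⟨c, step_mem_ball hb hbc, h⟩]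
    · rintro ⟨c, hc | ⟨b, hb, hbc⟩, h⟩
      exacts [⟨c, hc, Or.inl h⟩, ⟨b, hb, Or.inr ⟨c, hbc, h⟩⟩]

/-- There are values of the variables `1, …, K` within distance `r` of the value of `0` for
which `φ` holds there. -/
noncomputable def existsNear (r : ℕ) : ℕ → HLB P I → HLB P I
  | 0, φ => atVar 0 φ
  | K + 1, φ => atVar 0 (reach r (bind (K + 1) (existsNear r K φ)))

theorem freeVars_existsNear (r K : ℕ) (φ : HLB P I) :
    (existsNear r K φ).freeVars ⊆ {0} ∪ (φ.freeVars \ Set.Icc 1 K) := by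
  induction K with
  | zero => simp [existsNear, freeVars]
  | succ K ih =>
    refine Set.union_subset Set.subset_union_left ((freeVars_reach r _).trans ?_)
    rintro x ⟨hx, hxK⟩
    rcases ih hx with hx | ⟨hx, hx'⟩
    · exact Or.inl hx
    · refine Or.inr ⟨hx, fun h => hx' ⟨h.1, ?_⟩⟩
      have := h.2
      have : x ≠ K + 1 := hxK
      omega

theorem exists_of_sat_existsNear {r K : ℕ} {φ : HLB P I} {M : LTS P I} {a : M.Dom}
    {g : ℕ → M.Dom} (h : Sat M a g (existsNear r K φ)) :
    ∃ g' : ℕ → M.Dom, g' 0 = g 0 ∧ Sat M (g 0) g' φ := by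
  induction K generalizing a g with
  | zero => exact ⟨g, rfl, h⟩
  | succ K ih =>
    obtain ⟨b, -, hb⟩ := (sat_reach _ _ _ _ _).1 h
    obtain ⟨g', h0, hg'⟩ := ih hb
    rw [Function.update_of_ne (Nat.succ_ne_zero K).symm] at h0 hg'
    exact ⟨g', h0, hg'⟩

/-- The witness for each variable is its value under `g` itself, so rebinding it leaves `g`
unchanged. -/
theorem sat_existsNear {r : ℕ} {φ : HLB P I} {M : LTS P I} {g : ℕ → M.Dom}
    (hg : ∀ x, g x ∈ M.ball (g 0) r) (h : Sat M (g 0) g φ) (K : ℕ) (a : M.Dom) :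
    Sat M a g (existsNear r K φ) := by
  induction K generalizing a with
  | zero => exact h
  | succ K ih =>
    refine (sat_reach _ _ _ _ _).2 ⟨g (K + 1), hg _, ?_⟩
    simp only [Sat, Function.update_eq_self]
    exact ih _

end

section

variable [Finite P] [Finite I]

/-- The values of the variables `c t` describe a homomorphism from `T`. -/
noncomputable def homFormula (T : LTS P I) [Finite T.Dom] (c : T.Dom → ℕ) : HLB P I :=
  conj (atVar (c T.pt) (wvar 0)) (conj
    (conjAll fun q : {q : P × T.Dom // T.val q.1 q.2} => atVar (c q.1.2) (prop q.1.1))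
    (conjAll fun q : {q : I × T.Dom × T.Dom // T.rel q.1 q.2.1 q.2.2} =>
      atVar (c q.1.2.1) (dia q.1.1 (wvar (c q.1.2.2)))))

theorem sat_homFormula (T : LTS P I) [Finite T.Dom] (c : T.Dom → ℕ) (M : LTS P I) (a : M.Dom)
    (g : ℕ → M.Dom) (h0 : g 0 = M.pt) :
    Sat M a g (homFormula T c) ↔ IsHom T M (g ∘ c) := by
  simp only [homFormula, Sat, sat_conjAll, Subtype.forall, Prod.forall, h0,
    exists_eq_right']
  exact ⟨fun h => ⟨h.1.symm, h.2.1, h.2.2⟩, fun h => ⟨h.1.symm, h.2, h.3⟩⟩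

/-- The values of the variables `c (j, t)`, for `j < k`, describe `k` distinct homomorphisms
from `T`. -/
noncomputable def homsFormula (T : LTS P I) [Finite T.Dom] (k : ℕ) (c : Fin k × T.Dom → ℕ) :
    HLB P I :=
  conj (conjAll fun j => homFormula T fun t => c (j, t))
    (conjAll fun q : {q : Fin k × Fin k // q.1 ≠ q.2} =>
      neg (conjAll fun t => atVar (c (q.1.1, t)) (wvar (c (q.1.2, t)))))

theorem sat_homsFormula (T : LTS P I) [Finite T.Dom] (k : ℕ) (c : Fin k × T.Dom → ℕ)
    (M : LTS P I) (a : M.Dom) (g : ℕ → M.Dom) (h0 : g 0 = M.pt) :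
    Sat M a g (homsFormula T k c) ↔ (∀ j, IsHom T M fun t => g (c (j, t))) ∧
      Function.Injective fun (j : Fin k) t => g (c (j, t)) := by
  simp only [homsFormula, Sat, sat_conjAll, sat_homFormula T _ M a g h0, Subtype.forall,
    Prod.forall]
  refine and_congr Iff.rfl ⟨fun h i j hij => ?_, fun h i j hij hh => ?_⟩
  · by_contra hne
    exact h i j hne fun t => (congrFun hij t).symm
  · exact hij (h (funext fun t => (hh t).symm))

theorem freeVars_homsFormula (T : LTS P I) [Finite T.Dom] (k : ℕ) (c : Fin k × T.Dom → ℕ) :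
    (homsFormula T k c).freeVars ⊆ insert 0 (Set.range c) := by
  have h : ∀ q, {c q} ⊆ insert 0 (Set.range c) := fun q =>
    Set.singleton_subset_iff.2 (Or.inr ⟨q, rfl⟩)
  refine Set.union_subset (freeVars_conjAll fun j => ?_) (freeVars_conjAll fun q => ?_)
  · refine Set.union_subset (Set.union_subset (h _) (by simp [freeVars]))
      (Set.union_subset (freeVars_conjAll fun q => ?_) (freeVars_conjAll fun q => ?_))
    · exact Set.union_subset (h _) (Set.empty_subset _)
    · exact Set.union_subset (h _) (h _)
  · exact freeVars_conjAll fun t => Set.union_subset (h _) (h _)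

/-- With `k` the count for `M`, the sentence `φ` asserts `k` distinct homomorphisms near the root.
In `N` their distinctness alone gives the bound; the radius matters only for the truth of `φ` in
`M`. -/
theorem Equivalent.homCount_le {M : LTS P I} {N : LTS P I} (h : Equivalent M N)
    (hM : M.DegreeFinite) (hN : N.DegreeFinite) {T : LTS P I} [Finite T.Dom]
    (hT : T.Connected) : homCount T M ≤ homCount T N := by
  obtain ⟨r, hr⟩ := hT.exists_ball
  have hfinM := (hM.finite_homSet hT).to_subtype
  have hfinN := (hN.finite_homSet hT).to_subtype
  set k := homCount T M with hk
  have H : Fin k ≃ HomSet T M := (Finite.equivFin (HomSet T M)).symm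
  let e := Finite.equivFin (Fin k × T.Dom)
  -- The shift by one reserves variable `0` for the root, and the range of `c` is exactly the block
  -- of variables bound by `existsNear`.
  let c : Fin k × T.Dom → ℕ := fun q => (e q : ℕ) + 1
  have hc : Function.Injective c := fun q q' hq =>
    e.injective (Fin.ext (Nat.add_right_cancel hq))
  let φ : HLB P I := bind 0 (existsNear r (Nat.card (Fin k × T.Dom)) (homsFormula T k c))
  have hφ : φ.IsSentence := by
    refine Set.eq_empty_of_forall_notMem ?_
    rintro x ⟨hx, hx0⟩
    rcases freeVars_existsNear _ _ _ hx with hx | ⟨hx, hx'⟩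
    · exact hx0 hx
    · rcases freeVars_homsFormula _ _ _ hx with hx | ⟨q, rfl⟩
      · exact hx0 hx
      · exact hx' ⟨Nat.succ_pos _, (e q).2⟩
  have hMφ : Models M φ := by
    -- The default value `M.pt` gives variable `0` its intended value and keeps all unused variables
    -- in the ball.
    let g : ℕ → M.Dom := Function.extend c (fun q => (H q.1).1 q.2) fun _ => M.pt
    have hgc : ∀ q, g (c q) = (H q.1).1 q.2 := fun q => hc.extend_apply _ _ q
    have hg0 : g 0 = M.pt := Function.extend_apply' _ _ _ fun ⟨q, hq⟩ => Nat.succ_ne_zero _ hq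
    rw [models_iff_sat M φ hφ g]
    change Sat M M.pt (Function.update g 0 M.pt) _
    rw [← hg0, Function.update_eq_self]
    refine sat_existsNear (fun x => ?_) ?_ _ _
    · rw [hg0]
      by_cases hx : ∃ q, c q = x
      · obtain ⟨q, rfl⟩ := hx
        rw [hgc]
        exact (H q.1).2.map_ball (hr q.2)
      · rw [show g x = M.pt from Function.extend_apply' _ _ _ hx]
        exact M.self_mem_ball _ _
    · refine (sat_homsFormula _ _ _ _ _ _ hg0).2 ?_
      simp only [hgc]
      exact ⟨fun j => (H j).2, Subtype.val_injective.comp H.injective⟩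
  obtain ⟨g, hg0, hg⟩ := exists_of_sat_existsNear ((h φ hφ).1 hMφ fun _ => N.pt)
  rw [Function.update_self] at hg0
  obtain ⟨hhom, hinj⟩ := (sat_homsFormula _ _ _ _ _ _ hg0).1 hg
  have := Nat.card_le_card_of_injective (fun j : Fin k => (⟨_, hhom j⟩ : HomSet T N))
    fun i j hij => hinj (congrArg Subtype.val hij)
  rwa [Nat.card_fin, Nat.card_coe_set_eq] at this

end

theorem Equivalent.symm {M : LTS P I} {N : LTS P I} (h : Equivalent M N) : Equivalent N M :=
  fun φ hφ => (h φ hφ).symm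

end HLB

theorem mainTheorem7 {P I : Type*} [Finite P] [Finite I] (M : LTS P I) (N : LTS P I)
    (hM : M.DegreeFinite) (hN : N.DegreeFinite) :
    (∀ T ∈ LTS.finiteConnected P I, (LTS.HomSet T M).Finite ∧ (LTS.HomSet T N).Finite) ∧
    (HLB.Equivalent M N ↔
      LTS.homVector (LTS.finiteConnected P I) M = LTS.homVector (LTS.finiteConnected P I) N) := by
  refine ⟨fun T hT => ?_, fun h => ?_, fun h => ?_⟩
  · have := hT.1
    exact ⟨hM.finite_homSet hT.2, hN.finite_homSet hT.2⟩
  · funext T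
    have := T.2.1
    exact le_antisymm (h.homCount_le hM hN T.2.2) (h.symm.homCount_le hN hM T.2.2)
  · exact HLB.equivalent_of_ballIso
      (LTS.exists_ballIso hM hN fun T hT => congrFun h ⟨T, hT⟩)
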